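/- Let $M$ be a smooth ($C^\infty$, Hausdorff, second countable, boundaryless) manifold of finite dimension $n\ge 1$. Put $T^0M=M$, $T^{r+1}M=T(T^rM)$, and let $\pi_r\colon T^{r+1}M\to T^rM$ be the canonical projection. For $r\ge 2$ let $\kappa_r\colon T^rM\to T^rM$ be the canonical involution, given in canonical local coordinates over $T^{r-2}M$ by $\kappa_r(x,y,X,Y)=(x,X,y,Y)$. For $r\ge 1$ let $T^rM\setminus\{0\}=\{\xi\in T^rM : (D\pi_{T^{r-1}M\to M})(\xi)\neq 0\}$, where $\pi_{T^{r-1}M\to M}$ is the composed projection ($\mathrm{id}_M$ for $r=1$). A semispray on $T^rM$ is a smooth vector field $S$ on $T^{r+1}M\setminus\{0\}$ with $D\pi_r\circ S=\mathrm{id}$. A smooth curve $\gamma\colon I\to T^rM$ is a geodesic of $S$ if $\gamma'(t)\in T^{r+1}M\setminus\{0\}$ for all $t\in I$ and $\gamma''=S\circ\gamma'$. The complete lifts of a semispray $S$ on $M$ are the semisprays $S^{(r)}$ on $T^rM$ defined by $S^{(0)}=S$ and $S^{(r+1)}=D\kappa_{r+2}\circ\kappa_{r+3}\circ DS^{(r)}\circ\kappa_{r+2}$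 for $r\ge 0$. Proposition. Let $S$ be a semispray on $M$, let $I\subset\mathbb R$ be an open interval containing $0$ (possibly unbounded), and let $j\colon I\to T^rM$ be a geodesic of $S^{(r)}$. 1. If $r\ge 1$, then $\pi_{r-1}\circ j\colon I\to T^{r-1}M$ is a geodesic of $S^{(r-1)}$. 2. If $r\ge 2$, then $\kappa_r\circ j\colon I\to T^rM$ is a geodesic of $S^{(r)}$. 3. If $r\ge 2$, then $D\pi_{r-2}\circ j\colon I\to T^{r-1}M$ is a geodesic of $S^{(r-1)}$. -/

import Mathlib

open scoped Manifold ContDiff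

noncomputable section

namespace IteratedLift

universe u

/-- A `C^∞` manifold without boundary, modelled on a finite-dimensional real vector space, bundled
with its model so that the tangent bundle construction can be iterated. (The separation and
countability axioms play no role in the definitions and are assumed on the base manifold.) -/
structure Mfd where
  E : Type
  [normedAddCommGroup : NormedAddCommGroup E]
  [normedSpace : NormedSpace ℝ E]
  [finiteDimensional : FiniteDimensional ℝ E]
  H : Type
  [topologicalSpaceModel : TopologicalSpace H]
  model : ModelWithCorners ℝ E H
  [boundaryless : model.Boundaryless]
  carrier : Type u
  [topologicalSpace : TopologicalSpace carrier]
  [chartedSpace : ChartedSpace H carrier]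
  [isManifold : IsManifold model ∞ carrier]

namespace Mfd

attribute [instance] normedAddCommGroup normedSpace finiteDimensional topologicalSpaceModel
  boundaryless topologicalSpace chartedSpace isManifold

instance : CoeSort Mfd.{u} (Type u) := ⟨Mfd.carrier⟩

/-- An `n`-dimensional smooth manifold, as a bundled manifold. -/
abbrev of (n : ℕ) (M : Type u) [TopologicalSpace M]
    [ChartedSpace (EuclideanSpace ℝ (Fin n)) M] [IsManifold (𝓡 n) ∞ M] : Mfd.{u} where
  E := EuclideanSpace ℝ (Fin n)
  H := EuclideanSpace ℝ (Fin n)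
  model := 𝓡 n
  carrier := M

/-- The tangent bundle `TX`, with its canonical smooth structure. -/
abbrev T (X : Mfd.{u}) : Mfd.{u} where
  E := X.E × X.E
  H := ModelProd X.H X.E
  model := X.model.tangent
  carrier := TangentBundle X.model X

/-- The canonical projection `TX → X`. -/
def proj (X : Mfd.{u}) : X.T → X := fun ξ => ξ.proj

/-- The tangent map `Df : TX → TY` of a map `f : X → Y`. For a map that is smooth on an open set
`U` only, it has its meaning on the points of `TX` over `U`. -/
def D {X Y : Mfd.{u}} (f : X → Y) : X.T → Y.T := tangentMap X.model Y.model f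

/-- The tangent `γ' : ℝ → TX` of a curve `γ` in `X`. If `γ` is only of interest on an open set of
parameters, then so is `γ'`. -/
def tangent {X : Mfd.{u}} (γ : ℝ → X) : ℝ → X.T :=
  fun t => ⟨γ t, mfderiv 𝓘(ℝ, ℝ) X.model γ t (1 : ℝ)⟩

/-- The canonical involution of `TTX`, in coordinates `(x, y, X, Y) ↦ (x, X, y, Y)`.

An element of `TTX` is `⟨⟨x, y⟩, (X, Y)⟩`, where `y` is the component vector with respect to the
preferred chart of `X` at `x`, and `(X, Y)` is the component vector with respect to the preferred
chart of `TX` at `⟨x, y⟩`; the latter chart is the one induced by the former, so that `x, y, X, Y`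
are the canonical induced coordinates of the element. -/
def flip (X : Mfd.{u}) : X.T.T → X.T.T :=
  fun ξ =>
    let x : X := ξ.proj.proj
    let y : X.E := ξ.proj.snd
    let v : X.E × X.E := ξ.snd
    ⟨⟨x, v.1⟩, (y, v.2)⟩

/-- The iterated tangent bundle `T^r X`. -/
def iterT (X : Mfd.{u}) : ℕ → Mfd.{u}
  | 0 => X
  | r + 1 => (iterT X r).T

/-- The projection `π_r : T^{r+1} X → T^r X`. -/
def pi (X : Mfd.{u}) (r : ℕ) : X.iterT (r + 1) → X.iterT r := (X.iterT r).proj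

/-- The projection `π_{T^r X → X}`. -/
def piBase (X : Mfd.{u}) : (r : ℕ) → X.iterT r → X
  | 0 => id
  | r + 1 => piBase X r ∘ X.pi r

/-- The canonical involution `κ_r : T^r X → T^r X`, with `κ_1 = id`
(and, by convention, `κ_0 = id`). -/
def kappa (X : Mfd.{u}) : (r : ℕ) → X.iterT r → X.iterT r
  | 0 => id
  | 1 => id
  | r + 2 => (X.iterT r).flip

/-- The slashed tangent bundle: all of `X` for `r = 0`, and for `r ≥ 1` the elements `ξ` of `T^r X`
with `Dπ_{T^{r-1} X → X} (ξ) ≠ 0`. -/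
def slashed (X : Mfd.{u}) : (r : ℕ) → Set (X.iterT r)
  | 0 => Set.univ
  | r + 1 => {ξ | (D (X := X.iterT r) (X.piBase r) ξ).snd ≠ 0}

/-- `S` is a semispray on `T^r X`: a smooth vector field on the slashed `T^{r+1} X` with
`Dπ_r ∘ S = id`. The values of `S` outside the slashed bundle are irrelevant. -/
structure IsSemispray (X : Mfd.{u}) (r : ℕ) (S : X.iterT (r + 1) → X.iterT (r + 2)) : Prop where
  smooth : ContMDiffOn (X.iterT (r + 1)).model (X.iterT (r + 2)).model ∞ S (X.slashed (r + 1))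
  vectorField : ∀ ξ ∈ X.slashed (r + 1), X.pi (r + 1) (S ξ) = ξ
  section_D_pi : ∀ ξ ∈ X.slashed (r + 1),
    D (X := X.iterT (r + 1)) (Y := X.iterT r) (X.pi r) (S ξ) = ξ

/-- The iterated complete lifts `S^{(r)}` of `S`: `S^{(0)} = S` and
`S^{(r+1)} = Dκ_{r+2} ∘ κ_{r+3} ∘ DS^{(r)} ∘ κ_{r+2}`. -/
def completeLift (X : Mfd.{u}) (S : X.iterT 1 → X.iterT 2) :
    (r : ℕ) → X.iterT (r + 1) → X.iterT (r + 2)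
  | 0 => S
  | r + 1 =>
    D (X := X.iterT (r + 2)) (Y := X.iterT (r + 2)) (X.kappa (r + 2)) ∘ X.kappa (r + 3) ∘
      D (X := X.iterT (r + 1)) (Y := X.iterT (r + 2)) (completeLift X S r) ∘ X.kappa (r + 2)

/-- `γ : I → T^r X` is a geodesic of the semispray `S` on `T^r X`, where `I` is an open interval:
`γ` is smooth and regular on `I`, and `γ'' = S ∘ γ'` on `I`. -/
structure IsGeodesic (X : Mfd.{u}) (r : ℕ) (S : X.iterT (r + 1) → X.iterT (r + 2))
    (I : Set ℝ) (γ : ℝ → X.iterT r) : Prop where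
  smooth : ContMDiffOn 𝓘(ℝ, ℝ) (X.iterT r).model ∞ γ I
  regular : ∀ t ∈ I, tangent γ t ∈ X.slashed (r + 1)
  eq : ∀ t ∈ I, tangent (X := X.iterT (r + 1)) (tangent γ) t = S (tangent γ t)

end Mfd

end IteratedLift

end

noncomputable section

open Bundle Set Filter Topology

/-! A map f carries geodesics of S to geodesics of S' as soon as Df respects the slashed bundles and
DDf ∘ S = S' ∘ Df there, because (f ∘ γ)'' = DDf ∘ γ'' (`IsGeodesic.comp`). For f = π this identity
is a cancellation (`D_D_proj_liftStep`): Dπ ∘ κ is the other projection, and DS covers S. For f = κ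
it is a computation with words in the involutions of the iterated bundles
(`D_D_flip_liftStep_liftStep`), resting on the braid relation `flip_braid` and the naturality
`D_D_flip`. The third statement follows from the other two, since Dπ = π ∘ κ. The analytic input is
the symmetry of second derivatives. It makes the swap of the middle coordinates commute with chart
changes, so that κ is smooth with a linear chart expression, and it gives the naturality of κ. -/

theorem ContDiffAt.hasFDerivAt_tangentMap {E E' : Type*} [NormedAddCommGroup E] [NormedSpace ℝ E]
    [NormedAddCommGroup E'] [NormedSpace ℝ E'] {n : ℕ∞ω} {F : E → E'} {a : E}
    (hF : ContDiffAt ℝ n F a) (hn : 2 ≤ n) (v : E) :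
    HasFDerivAt (fun q : E × E => (F q.1, fderiv ℝ F q.1 q.2))
      (((fderiv ℝ F a).comp (ContinuousLinearMap.fst ℝ E E)).prod
        ((fderiv ℝ F a).comp (ContinuousLinearMap.snd ℝ E E) +
          ((fderiv ℝ (fderiv ℝ F) a).comp (ContinuousLinearMap.fst ℝ E E)).flip v)) (a, v) := by
  have hF' : DifferentiableAt ℝ (fderiv ℝ F) a :=
    (hF.fderiv_right (m := 1) hn).differentiableAt (by simp)
  have h1 : HasFDerivAt (fun q : E × E => F q.1)
      ((fderiv ℝ F a).comp (ContinuousLinearMap.fst ℝ E E)) (a, v) :=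
    HasFDerivAt.comp (g := F) _
      (hF.differentiableAt (by rintro rfl; simp at hn)).hasFDerivAt hasFDerivAt_fst
  have h2 : HasFDerivAt (fun q : E × E => fderiv ℝ F q.1)
      ((fderiv ℝ (fderiv ℝ F) a).comp (ContinuousLinearMap.fst ℝ E E)) (a, v) :=
    HasFDerivAt.comp (g := fderiv ℝ F) _ hF'.hasFDerivAt hasFDerivAt_fst
  exact h1.prodMk (h2.clm_apply hasFDerivAt_snd)

/-! ### Tangent maps read in induced charts -/

section ChartComputations

variable {E : Type*} [NormedAddCommGroup E] [NormedSpace ℝ E] {H : Type*} [TopologicalSpace H]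
  {I : ModelWithCorners ℝ E H} {M : Type*} [TopologicalSpace M] [ChartedSpace H M]
  {E' : Type*} [NormedAddCommGroup E'] [NormedSpace ℝ E'] {H' : Type*} [TopologicalSpace H']
  {J : ModelWithCorners ℝ E' H'} {N : Type*} [TopologicalSpace N] [ChartedSpace H' N]

theorem MDifferentiableAt.hasFDerivAt_writtenInExtChartAt [I.Boundaryless] {f : M → N} {z : M}
    (hf : MDifferentiableAt I J f z) :
    HasFDerivAt (𝕜 := ℝ) (E := E) (F := E') (writtenInExtChartAt I J z f) (mfderiv I J f z)
      (extChartAt I z z) := by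
  have key : ∀ A : E →L[ℝ] E',
      HasFDerivWithinAt (writtenInExtChartAt I J z f) A (range I) (extChartAt I z z) →
        HasFDerivAt (writtenInExtChartAt I J z f) A (extChartAt I z z) := by
    intro A hA
    rwa [I.range_eq_univ, hasFDerivWithinAt_univ] at hA
  exact key _ hf.hasMFDerivAt.2

theorem MDifferentiableAt.mfderiv_eq_fderiv [I.Boundaryless] {f : M → N} {z : M}
    (hf : MDifferentiableAt I J f z) :
    (mfderiv I J f z : E →L[ℝ] E') =
      fderiv ℝ (writtenInExtChartAt I J z f) (extChartAt I z z) := by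
  have key : ∀ A : E →L[ℝ] E', HasFDerivAt (writtenInExtChartAt I J z f) A (extChartAt I z z) →
      A = fderiv ℝ (writtenInExtChartAt I J z f) (extChartAt I z z) := fun A hA => hA.fderiv.symm
  exact key _ hf.hasFDerivAt_writtenInExtChartAt

section

variable [IsManifold I 1 M] [IsManifold J 1 N]

theorem extChartAt_tangent_apply (p q : TangentBundle I M) :
    extChartAt I.tangent p q =
      (extChartAt I p.proj q.proj, tangentCoordChange I q.proj p.proj q.proj q.snd) :=
  rfl

theorem extChartAt_tangent_self (p : TangentBundle I M) :
    extChartAt I.tangent p p = (extChartAt I p.proj p.proj, p.snd) := by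
  exact Prod.ext rfl (tangentCoordChange_self (mem_extChartAt_source _))

variable [I.Boundaryless] [J.Boundaryless]

theorem hasFDerivAt_tangentCoordChange {x y z : M}
    (h : z ∈ (extChartAt I x).source ∩ (extChartAt I y).source) :
    HasFDerivAt ((extChartAt I y) ∘ (extChartAt I x).symm) (tangentCoordChange I x y z)
      (extChartAt I x z) := by
  have := hasFDerivWithinAt_tangentCoordChange (I := I) h
  rwa [I.range_eq_univ, hasFDerivWithinAt_univ] at this

/-- In the charts induced by charts around `p.proj` and `f p.proj`, the tangent map of `f` is
`(a, v) ↦ (F a, F' a v)`, where `F` is `f` read in these charts. -/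
theorem writtenInExtChartAt_tangentMap_eventuallyEq {f : M → N} (p : TangentBundle I M)
    (hf : ∀ᶠ z in 𝓝 p.proj, MDifferentiableAt I J f z) :
    writtenInExtChartAt I.tangent J.tangent p (tangentMap I J f) =ᶠ[𝓝 (extChartAt I.tangent p p)]
      fun q => (writtenInExtChartAt I J p.proj f q.1,
        fderiv ℝ (writtenInExtChartAt I J p.proj f) q.1 q.2) := by
  have hc : ContinuousAt f p.proj := hf.self_of_nhds.continuousAt
  have h1 : ∀ᶠ z in 𝓝 p.proj,
      f z ∈ (extChartAt J (f p.proj)).source ∧ MDifferentiableAt I J f z :=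
    (hc.eventually_mem (extChartAt_source_mem_nhds (I := J) (f p.proj))).and hf
  have h2 : ∀ᶠ a in 𝓝 (extChartAt I p.proj p.proj),
      f ((extChartAt I p.proj).symm a) ∈ (extChartAt J (f p.proj)).source ∧
        MDifferentiableAt I J f ((extChartAt I p.proj).symm a) := by
    have hs := continuousAt_extChartAt_symm (I := I) p.proj
    rw [ContinuousAt, extChartAt_to_inv] at hs
    exact hs.eventually h1
  have h3 : ∀ᶠ a in 𝓝 (extChartAt I p.proj p.proj), a ∈ (extChartAt I p.proj).target :=
    extChartAt_target_mem_nhds p.proj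
  rw [extChartAt_tangent_self]
  filter_upwards [(continuous_fst.tendsto (extChartAt I p.proj p.proj, (p.snd : E))).eventually
    (h3.and h2)]
  rintro ⟨a, v⟩ ⟨ha, hfa, hd⟩
  dsimp only at ha hfa hd
  set z := (extChartAt I p.proj).symm a with hz
  have hzs : z ∈ (extChartAt I p.proj).source := (extChartAt I p.proj).map_target ha
  have haz : extChartAt I p.proj z = a := (extChartAt I p.proj).right_inv ha
  have e1 : HasFDerivAt (extChartAt I z ∘ (extChartAt I p.proj).symm)
      (tangentCoordChange I p.proj z z) a := by
    have := hasFDerivAt_tangentCoordChange (I := I) (x := p.proj) (y := z) (z := z)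
      ⟨hzs, mem_extChartAt_source _⟩
    rwa [haz] at this
  have e2 := hd.hasFDerivAt_writtenInExtChartAt
  have e3 := hasFDerivAt_tangentCoordChange (I := J) (x := f z) (y := f p.proj) (z := f z)
      ⟨mem_extChartAt_source _, hfa⟩
  -- Near `a`, the expression of `f` in the charts at `p` is its expression in the charts at `z`,
  -- conjugated by chart changes. The chain rule then yields exactly the linear map that the bundle
  -- charts apply to `v`.
  have e4 : HasFDerivAt (writtenInExtChartAt I J p.proj f)
      ((tangentCoordChange J (f z) (f p.proj) (f z)).comp
        ((mfderiv I J f z).comp (tangentCoordChange I p.proj z z))) a := by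
    have e2' : HasFDerivAt (writtenInExtChartAt I J z f) (mfderiv I J f z)
      ((extChartAt I z ∘ (extChartAt I p.proj).symm) a) := e2
    have e12 := e2'.comp a e1
    have e3' : HasFDerivAt (extChartAt J (f p.proj) ∘ (extChartAt J (f z)).symm)
        (tangentCoordChange J (f z) (f p.proj) (f z))
        ((writtenInExtChartAt I J z f ∘ (extChartAt I z ∘ (extChartAt I p.proj).symm)) a) := by
      simpa only [writtenInExtChartAt, Function.comp_apply, extChartAt_to_inv, ← hz] using e3
    refine (e3'.comp a e12).congr_of_eventuallyEq ?_
    have c1 : Tendsto (extChartAt I p.proj).symm (𝓝 a) (𝓝 z) :=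
      continuousAt_extChartAt_symm'' ha
    filter_upwards [c1.eventually_mem (extChartAt_source_mem_nhds (I := I) z),
      c1.eventually (hd.continuousAt.eventually_mem
        (extChartAt_source_mem_nhds (I := J) (f z)))] with b hb hb'
    simp only [writtenInExtChartAt, Function.comp_apply, (extChartAt I z).left_inv hb,
      (extChartAt J (f z)).left_inv hb']
  dsimp only
  rw [e4.fderiv]
  rfl

end

theorem ContMDiffAt.contDiffAt_writtenInExtChartAt [I.Boundaryless] {n : ℕ∞ω} {f : M → N} {z : M}
    (hf : ContMDiffAt I J n f z) :
    ContDiffAt ℝ n (writtenInExtChartAt I J z f) (extChartAt I z z) := by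
  have := (contMDiffAt_iff.1 hf).2
  rwa [I.range_eq_univ, contDiffWithinAt_univ] at this

theorem ContMDiffOn.fderiv_fderiv_writtenInExtChartAt_comm [I.Boundaryless] {f : M → N} {U : Set M} (hU : IsOpen U)
    (hf : ContMDiffOn I J ∞ f U) {x : M} (hx : x ∈ U) (y X : E) :
    fderiv ℝ (fderiv ℝ (writtenInExtChartAt I J x f)) (extChartAt I x x) X y =
      fderiv ℝ (fderiv ℝ (writtenInExtChartAt I J x f)) (extChartAt I x x) y X := by
  have hF := (hf.contMDiffAt (hU.mem_nhds hx)).contDiffAt_writtenInExtChartAt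
  exact hF.isSymmSndFDerivAt (by simp; norm_cast) X y

variable [IsManifold I ∞ M] [IsManifold J ∞ N]

theorem ContMDiffOn.tangentMap_of_isOpen {f : M → N} {U : Set M} (hU : IsOpen U)
    (hf : ContMDiffOn I J ∞ f U) :
    ContMDiffOn I.tangent J.tangent ∞ (tangentMap I J f)
      ((TotalSpace.proj : TangentBundle I M → M) ⁻¹' U) := by
  refine (hf.contMDiffOn_tangentMapWithin (m := ∞) (by simp) hU.uniqueMDiffOn).congr ?_
  intro p hp
  exact (tangentMapWithin_eq_tangentMap (hU.uniqueMDiffOn _ hp)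
    ((hf.contMDiffAt (hU.mem_nhds hp)).mdifferentiableAt (by simp))).symm

variable [I.Boundaryless] [J.Boundaryless]

/-- Differentiates (a, v) ↦ (F a, F'(a) v) at (x, y). The second-order term F''(X, y) is the only
one that mixes y and X. -/
theorem mfderiv_tangentMap_apply {f : M → N} {U : Set M} (hU : IsOpen U)
    (hf : ContMDiffOn I J ∞ f U) {x : M} (hx : x ∈ U) (y X Y : E) :
    (mfderiv I.tangent J.tangent (tangentMap I J f) (⟨x, y⟩ : TangentBundle I M) :
      E × E →L[ℝ] E' × E') (X, Y) =
      (fderiv ℝ (writtenInExtChartAt I J x f) (extChartAt I x x) X,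
        fderiv ℝ (fderiv ℝ (writtenInExtChartAt I J x f)) (extChartAt I x x) X y +
          fderiv ℝ (writtenInExtChartAt I J x f) (extChartAt I x x) Y) := by
  have hev : ∀ᶠ z in 𝓝 x, MDifferentiableAt I J f z := by
    filter_upwards [hU.mem_nhds hx] with z hz
    exact (hf.contMDiffAt (hU.mem_nhds hz)).mdifferentiableAt (by simp)
  have hT : MDifferentiableAt I.tangent J.tangent (tangentMap I J f) (⟨x, y⟩ : TangentBundle I M) :=
    ((hf.tangentMap_of_isOpen hU).contMDiffAt
      ((hU.preimage (FiberBundle.continuous_proj E _)).mem_nhds hx)).mdifferentiableAt (by simp)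
  have hF := (hf.contMDiffAt (hU.mem_nhds hx)).contDiffAt_writtenInExtChartAt
  have h4 := writtenInExtChartAt_tangentMap_eventuallyEq (⟨x, y⟩ : TangentBundle I M) hev
  erw [hT.mfderiv_eq_fderiv, h4.fderiv_eq, extChartAt_tangent_self,
    (hF.hasFDerivAt_tangentMap (by norm_cast) y).fderiv]
  exact Prod.ext rfl (add_comm _ _)

end ChartComputations

/-! ### Chart changes of the second tangent bundle -/

section ChartComputations

variable {E : Type*} [NormedAddCommGroup E] [NormedSpace ℝ E] {H : Type*} [TopologicalSpace H]
  {I : ModelWithCorners ℝ E H} {M : Type*} [TopologicalSpace M] [ChartedSpace H M]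
  [IsManifold I ∞ M] [I.Boundaryless]

/-- By the cocycle identity, a chart change of TM is the tangent map of a chart change of M.
Differentiating once more gives the chart changes of TTM. -/
theorem extChartAt_tangent_comp_symm_eventuallyEq (p q : TangentBundle I M)
    (h : q.proj ∈ (extChartAt I p.proj).source) :
    extChartAt I.tangent p ∘ (extChartAt I.tangent q).symm =ᶠ[𝓝 (extChartAt I.tangent q q)]
      fun r => ((extChartAt I p.proj ∘ (extChartAt I q.proj).symm) r.1,
        fderiv ℝ (extChartAt I p.proj ∘ (extChartAt I q.proj).symm) r.1 r.2) := by
  have h1 : ∀ᶠ a in 𝓝 (extChartAt I q.proj q.proj), a ∈ (extChartAt I q.proj).target :=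
    extChartAt_target_mem_nhds q.proj
  have h2 : ∀ᶠ a in 𝓝 (extChartAt I q.proj q.proj),
      (extChartAt I q.proj).symm a ∈ (extChartAt I p.proj).source := by
    have hs := continuousAt_extChartAt_symm (I := I) q.proj
    rw [ContinuousAt, extChartAt_to_inv] at hs
    exact hs.eventually_mem ((isOpen_extChartAt_source (I := I) p.proj).mem_nhds h)
  rw [extChartAt_tangent_self]
  filter_upwards [(continuous_fst.tendsto (extChartAt I q.proj q.proj, (q.snd : E))).eventually
    (h1.and h2)]
  rintro ⟨a, v⟩ ⟨ha, hpa⟩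
  dsimp only at ha hpa
  have hqa := (extChartAt I q.proj).map_target ha
  have hd := (hasFDerivAt_tangentCoordChange (I := I) (x := q.proj) (y := p.proj) ⟨hqa, hpa⟩).fderiv
  rw [(extChartAt I q.proj).right_inv ha] at hd
  rw [hd]
  exact Prod.ext rfl (tangentCoordChange_comp ⟨⟨hqa, mem_extChartAt_source _⟩, hpa⟩)

theorem contDiffAt_extChartAt_comp_symm {x z : M} (h : z ∈ (extChartAt I x).source) :
    ContDiffAt ℝ ∞ (extChartAt I x ∘ (extChartAt I z).symm) (extChartAt I z z) := by
  have := contDiffWithinAt_ext_coord_change (I := I) (n := ∞) x z (y := extChartAt I z z) (by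
    simpa only [PartialEquiv.trans_source, PartialEquiv.symm_source, mem_inter_iff, mem_preimage,
      extChartAt_to_inv] using ⟨mem_extChartAt_target z, h⟩)
  rwa [I.range_eq_univ, contDiffWithinAt_univ] at this

theorem extChartAt_tangent_tangent_apply (ξ η : TangentBundle I.tangent (TangentBundle I M))
    (h : η.proj.proj ∈ (extChartAt I ξ.proj.proj).source) :
    extChartAt I.tangent.tangent ξ η =
      ((extChartAt I ξ.proj.proj η.proj.proj,
        fderiv ℝ (extChartAt I ξ.proj.proj ∘ (extChartAt I η.proj.proj).symm)
          (extChartAt I η.proj.proj η.proj.proj) η.proj.snd),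
       (fderiv ℝ (extChartAt I ξ.proj.proj ∘ (extChartAt I η.proj.proj).symm)
          (extChartAt I η.proj.proj η.proj.proj) (η.snd : E × E).1,
        fderiv ℝ (fderiv ℝ (extChartAt I ξ.proj.proj ∘ (extChartAt I η.proj.proj).symm))
          (extChartAt I η.proj.proj η.proj.proj) (η.snd : E × E).1 η.proj.snd +
        fderiv ℝ (extChartAt I ξ.proj.proj ∘ (extChartAt I η.proj.proj).symm)
          (extChartAt I η.proj.proj η.proj.proj) (η.snd : E × E).2)) := by
  have hd := hasFDerivAt_tangentCoordChange (I := I) (x := η.proj.proj) (y := ξ.proj.proj)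
    ⟨mem_extChartAt_source _, h⟩
  have hd2 := hasFDerivAt_tangentCoordChange (I := I.tangent) (x := η.proj) (y := ξ.proj)
    (z := η.proj) ⟨mem_extChartAt_source _, by
      simpa only [extChartAt_source, TangentBundle.mem_chart_source_iff] using h⟩
  have h3 := (contDiffAt_extChartAt_comp_symm h).hasFDerivAt_tangentMap (by norm_cast) η.proj.snd
  have h4 := extChartAt_tangent_comp_symm_eventuallyEq ξ.proj η.proj h
  rw [extChartAt_tangent_apply, extChartAt_tangent_apply]
  rw [← hd2.fderiv, h4.fderiv_eq, ← hd.fderiv, extChartAt_tangent_self]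
  erw [h3.fderiv]
  exact Prod.ext rfl (Prod.ext rfl (add_comm _ _))

end ChartComputations

/-! ### The canonical involution: smoothness, derivative, braid relation -/

namespace IteratedLift.Mfd

universe u

/-- The linear map `(x, y, X, Y) ↦ (x, X, y, Y)`. -/
def swapMid (E : Type*) [NormedAddCommGroup E] [NormedSpace ℝ E] :
    (E × E) × (E × E) →L[ℝ] (E × E) × (E × E) :=
  (((ContinuousLinearMap.fst ℝ E E).comp (ContinuousLinearMap.fst ℝ (E × E) (E × E))).prod
    ((ContinuousLinearMap.fst ℝ E E).comp (ContinuousLinearMap.snd ℝ (E × E) (E × E)))).prod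
  (((ContinuousLinearMap.snd ℝ E E).comp (ContinuousLinearMap.fst ℝ (E × E) (E × E))).prod
    ((ContinuousLinearMap.snd ℝ E E).comp (ContinuousLinearMap.snd ℝ (E × E) (E × E))))

@[simp]
theorem swapMid_apply {E : Type*} [NormedAddCommGroup E] [NormedSpace ℝ E] (a b c d : E) :
    swapMid E ((a, b), (c, d)) = ((a, c), (b, d)) :=
  rfl

variable (X : Mfd.{u})

/-- In the canonical charts of `TTX`, the involution is `(x, y, X, Y) ↦ (x, X, y, Y)`. -/
theorem extChartAt_flip (ξ ξ' η : X.T.T) (hξ : ξ'.proj.proj = ξ.proj.proj)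
    (h : η.proj.proj ∈ (extChartAt X.model ξ.proj.proj).source) :
    extChartAt X.T.T.model ξ' (X.flip η) = swapMid X.E (extChartAt X.T.T.model ξ η) := by
  have hs := (contDiffAt_extChartAt_comp_symm (I := X.model) h).isSymmSndFDerivAt
    (by simp; norm_cast)
  have e1 := extChartAt_tangent_tangent_apply (I := X.model) ξ η h
  have e2 := extChartAt_tangent_tangent_apply (I := X.model) ξ' (X.flip η) (by rw [hξ]; exact h)
  rw [hξ] at e2
  refine e2.trans ((congrArg (swapMid X.E) e1).trans ?_).symm
  rw [swapMid_apply]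
  refine Prod.ext rfl (Prod.ext rfl (congrArg₂ (· + ·) (hs _ _) rfl))

theorem contMDiff_flip : ContMDiff X.T.T.model X.T.T.model ∞ X.flip := by
  intro ξ
  have hsrc : ∀ᶠ η in 𝓝 ξ, η ∈ (extChartAt X.T.T.model ξ).source := extChartAt_source_mem_nhds ξ
  have hmem : ∀ η : X.T.T, η ∈ (extChartAt X.T.T.model ξ).source →
      η.proj.proj ∈ (extChartAt X.model ξ.proj.proj).source := by
    intro η hη
    rw [extChartAt_source] at hη ⊢
    exact (TangentBundle.mem_chart_source_iff _ _).1
      ((TangentBundle.mem_chart_source_iff _ _).1 hη)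
  have hmem' : ∀ η : X.T.T, η ∈ (extChartAt X.T.T.model ξ).source →
      X.flip η ∈ (extChartAt X.T.T.model (X.flip ξ)).source := by
    intro η hη
    have := hmem η hη
    rw [extChartAt_source] at this ⊢
    exact (TangentBundle.mem_chart_source_iff _ _).2
      ((TangentBundle.mem_chart_source_iff _ _).2 this)
  have h1 : ContMDiffAt X.T.T.model 𝓘(ℝ, X.T.T.E) ∞ (extChartAt X.T.T.model ξ) ξ :=
    contMDiffAt_extChartAt
  have h2 : ContMDiffAt 𝓘(ℝ, X.T.T.E) 𝓘(ℝ, X.T.T.E) ∞ (swapMid X.E)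
      (extChartAt X.T.T.model ξ ξ) := (swapMid X.E).contDiff.contMDiff.contMDiffAt
  have h3 : ContMDiffAt 𝓘(ℝ, X.T.T.E) X.T.T.model ∞ (extChartAt X.T.T.model (X.flip ξ)).symm
      (swapMid X.E (extChartAt X.T.T.model ξ ξ)) := by
    rw [← extChartAt_flip X ξ (X.flip ξ) ξ rfl (hmem ξ (mem_extChartAt_source _))]
    exact (contMDiffOn_extChartAt_symm _).contMDiffAt (extChartAt_target_mem_nhds _)
  refine (h3.comp ξ (h2.comp ξ h1)).congr_of_eventuallyEq ?_
  filter_upwards [hsrc] with η hη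
  simp only [Function.comp_apply]
  rw [← extChartAt_flip X ξ (X.flip ξ) η rfl (hmem η hη)]
  exact ((extChartAt _ (X.flip ξ)).left_inv (hmem' η hη)).symm

/-- In the charts at `ξ` and `X.flip ξ` the involution is the linear map `swapMid`, hence its own
derivative. -/
theorem mfderiv_flip (ξ : X.T.T) :
    (mfderiv X.T.T.model X.T.T.model X.flip ξ : X.T.T.E →L[ℝ] X.T.T.E) = swapMid X.E := by
  have hd : MDifferentiableAt X.T.T.model X.T.T.model X.flip ξ :=
    X.contMDiff_flip.mdifferentiable (by simp) ξ
  have h : writtenInExtChartAt X.T.T.model X.T.T.model ξ X.flip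
      =ᶠ[𝓝 (extChartAt X.T.T.model ξ ξ)] swapMid X.E := by
    filter_upwards [extChartAt_target_mem_nhds (I := X.T.T.model) ξ] with a ha
    have hs := (extChartAt X.T.T.model ξ).map_target ha
    rw [extChartAt_source] at hs
    have hs' := (TangentBundle.mem_chart_source_iff _ _).1
      ((TangentBundle.mem_chart_source_iff _ _).1 hs)
    rw [← extChartAt_source X.model] at hs'
    refine (extChartAt_flip X ξ (X.flip ξ) _ rfl hs').trans ?_
    rw [(extChartAt X.T.T.model ξ).right_inv ha]
  rw [hd.mfderiv_eq_fderiv, h.fderiv_eq, ContinuousLinearMap.fderiv]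

theorem D_flip (ξ : X.T.T) (v : (X.E × X.E) × (X.E × X.E)) :
    D (X := X.T.T) (Y := X.T.T) X.flip ⟨ξ, v⟩ = ⟨X.flip ξ, swapMid X.E v⟩ :=
  congrArg (fun A : X.T.T.E →L[ℝ] X.T.T.E => (⟨X.flip ξ, A v⟩ : X.T.T.T)) (X.mfderiv_flip ξ)

theorem contMDiff_proj : ContMDiff X.T.model X.model ∞ X.proj :=
  Bundle.contMDiff_proj _

theorem mfderiv_proj (p : X.T) :
    (mfderiv X.T.model X.model X.proj p : X.T.E →L[ℝ] X.E) = ContinuousLinearMap.fst ℝ X.E X.E := by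
  have hd : MDifferentiableAt X.T.model X.model X.proj p :=
    X.contMDiff_proj.mdifferentiable (by simp) p
  have h : writtenInExtChartAt X.T.model X.model p X.proj
      =ᶠ[𝓝 (extChartAt X.T.model p p)] Prod.fst := by
    have h1 : ∀ᶠ a in 𝓝 (extChartAt X.model p.proj p.proj), a ∈ (extChartAt X.model p.proj).target :=
      extChartAt_target_mem_nhds p.proj
    rw [extChartAt_tangent_self]
    filter_upwards [(continuous_fst.tendsto
      (extChartAt X.model p.proj p.proj, (p.snd : X.E))).eventually h1] with a ha
    exact (extChartAt X.model p.proj).right_inv ha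
  rw [hd.mfderiv_eq_fderiv, h.fderiv_eq]
  exact fderiv_fst

theorem D_proj (p : X.T) (v : X.E × X.E) :
    D (X := X.T) (Y := X) X.proj ⟨p, v⟩ = ⟨p.proj, v.1⟩ :=
  congrArg (fun A : X.T.E →L[ℝ] X.E => (⟨p.proj, A v⟩ : X.T)) (X.mfderiv_proj p)

/-- Both sides are (x, X) when ξ = (x, y, X, Y). -/
theorem D_proj_eq_proj_flip (ξ : X.T.T) :
    D (X := X.T) (Y := X) X.proj ξ = X.T.proj (X.flip ξ) :=
  X.D_proj ξ.proj ξ.snd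

theorem D_proj_flip (ξ : X.T.T) :
    D (X := X.T) (Y := X) X.proj (X.flip ξ) = X.T.proj ξ :=
  X.D_proj_eq_proj_flip (X.flip ξ)

/-- The braid relation between the two canonical involutions of `TTTX`. -/
theorem flip_braid (Ξ : X.T.T.T) :
    D (X := X.T.T) (Y := X.T.T) X.flip (X.T.flip (D (X := X.T.T) (Y := X.T.T) X.flip Ξ)) =
      X.T.flip (D (X := X.T.T) (Y := X.T.T) X.flip (X.T.flip Ξ)) := by
  obtain ⟨ξ, v⟩ := Ξ
  -- With `D_flip` both sides become permutations of the eight components of Ξ, and these agree by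
  -- definition.
  exact (congrArg (fun ζ => D (X := X.T.T) (Y := X.T.T) X.flip (X.T.flip ζ)) (X.D_flip ξ v)).trans
    ((X.D_flip _ _).trans (congrArg X.T.flip
      (X.D_flip (X.T.flip ⟨ξ, v⟩).proj (X.T.flip ⟨ξ, v⟩).snd)).symm)

/-! ### Functoriality of D and naturality of the involution -/

variable {X} {Y Z : Mfd.{u}}

theorem D_comp_apply {f : X → Y} {g : Y → Z} {ξ : X.T} (hf : MDifferentiableAt X.model Y.model f ξ.proj)
    (hg : MDifferentiableAt Y.model Z.model g (f ξ.proj)) :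
    D (X := X) (Y := Z) (g ∘ f) ξ = D g (D f ξ) :=
  tangentMap_comp_at ξ hg hf

/-- DDf sends (x, y, X, Y) to (f x, F'y, F'X, F''(X, y) + F'Y), so exchanging y and X commutes with
it because F'' is symmetric. -/
theorem D_D_flip {f : X → Y} {U : Set X} (hU : IsOpen U) (hf : ContMDiffOn X.model Y.model ∞ f U)
    (ξ : X.T.T) (hξ : ξ.proj.proj ∈ U) :
    D (X := X.T) (Y := Y.T) (D f) (X.flip ξ) = Y.flip (D (X := X.T) (Y := Y.T) (D f) ξ) := by
  obtain ⟨⟨x, y⟩, v⟩ := ξ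
  have hd : MDifferentiableAt X.model Y.model f x :=
    (hf.contMDiffAt (hU.mem_nhds hξ)).mdifferentiableAt (by simp)
  have e1 := mfderiv_tangentMap_apply hU hf hξ y v.1 v.2
  have e2 := mfderiv_tangentMap_apply hU hf hξ v.1 y v.2
  have e3 := hf.fderiv_fderiv_writtenInExtChartAt_comm hU hξ v.1 y
  have e4 := hd.mfderiv_eq_fderiv
  -- Stated for plain vectors and linear maps, so that substitution avoids the dependence of tangent
  -- spaces on base points.
  have key : ∀ (A A2 : X.E →L[ℝ] Y.E) (w1 w2 : Y.E × Y.E) (b b' : Y.E),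
      A = A2 → w1 = (A2 v.1, b + A2 v.2) → w2 = (A2 y, b' + A2 v.2) → b' = b →
      (⟨⟨f x, A v.1⟩, w2⟩ : Y.T.T) = Y.flip ⟨⟨f x, A y⟩, w1⟩ := by
    rintro A A2 w1 w2 b b' rfl rfl rfl rfl
    rfl
  exact key _ _ _ _ _ _ e4 e1 e2 e3

theorem contMDiffOn_D {f : X → Y} {U : Set X} (hU : IsOpen U)
    (hf : ContMDiffOn X.model Y.model ∞ f U) :
    ContMDiffOn X.T.model Y.T.model ∞ (D f) (X.proj ⁻¹' U) :=
  hf.tangentMap_of_isOpen hU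

theorem contMDiff_D {f : X → Y} (hf : ContMDiff X.model Y.model ∞ f) :
    ContMDiff X.T.model Y.T.model ∞ (D f) :=
  hf.contMDiff_tangentMap (by simp)

/-- A nonzero fibre coordinate in one fixed chart is an open condition, and it forces `snd` to be
nonzero since coordinate changes are linear on fibres. -/
theorem isOpen_snd_ne_zero : IsOpen {ξ : X.T | ξ.snd ≠ 0} := by
  rw [isOpen_iff_mem_nhds]
  intro ξ hξ
  have hc : ContinuousAt (extChartAt X.T.model ξ) ξ := continuousAt_extChartAt ξ
  have h0 : (extChartAt X.T.model ξ ξ).2 ≠ 0 := by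
    rw [extChartAt_tangent_self]
    exact hξ
  filter_upwards [hc.snd.eventually_ne h0] with η hη h
  refine hη ?_
  rw [extChartAt_tangent_apply]
  exact (congrArg (tangentCoordChange X.model η.proj ξ.proj η.proj) h).trans (map_zero _)

/-! ### Tangents of curves -/

section Curves

variable {X Y : Mfd.{u}} {I : Set ℝ}

theorem contMDiffOn_tangent (hI : IsOpen I) {γ : ℝ → X} (hγ : ContMDiffOn 𝓘(ℝ, ℝ) X.model ∞ γ I) :
    ContMDiffOn 𝓘(ℝ, ℝ) X.T.model ∞ (tangent γ) I := by
  have h1 := hγ.tangentMap_of_isOpen hI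
  have h2 : ContMDiff 𝓘(ℝ, ℝ) 𝓘(ℝ, ℝ).tangent ∞
      (fun t : ℝ => (⟨t, (1 : ℝ)⟩ : TangentBundle 𝓘(ℝ, ℝ) ℝ)) :=
    contMDiff_vectorSpace_iff_contDiff.2 contDiff_const
  exact h1.comp h2.contMDiffOn fun t ht => ht

theorem tangent_comp (hI : IsOpen I) {γ : ℝ → X} (hγ : ContMDiffOn 𝓘(ℝ, ℝ) X.model ∞ γ I)
    {f : X → Y} (hf : ContMDiff X.model Y.model ∞ f) {t : ℝ} (ht : t ∈ I) :
    tangent (f ∘ γ) t = D f (tangent γ t) := by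
  have hd : MDifferentiableAt 𝓘(ℝ, ℝ) X.model γ t :=
    (hγ.contMDiffAt (hI.mem_nhds ht)).mdifferentiableAt (by simp)
  have := tangentMap_comp_at (I := 𝓘(ℝ, ℝ)) (⟨t, (1 : ℝ)⟩ : TangentBundle 𝓘(ℝ, ℝ) ℝ)
    (hf.mdifferentiable (by simp) (γ t)) hd
  exact this

theorem tangent_congr (hI : IsOpen I) {γ δ : ℝ → X} (h : EqOn γ δ I) {t : ℝ} (ht : t ∈ I) :
    tangent γ t = tangent δ t := by
  have he : γ =ᶠ[𝓝 t] δ := by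
    filter_upwards [hI.mem_nhds ht] with s hs using h hs
  have h1 : mfderiv 𝓘(ℝ, ℝ) X.model γ t = mfderiv 𝓘(ℝ, ℝ) X.model δ t := he.mfderiv_eq
  have key : ∀ (x y : X) (A B : ℝ →L[ℝ] X.E), x = y → A = B →
      (⟨x, A 1⟩ : X.T) = ⟨y, B 1⟩ := by
    rintro x y A B rfl rfl
    rfl
  exact key _ _ _ _ (h ht) h1

end Curves

/-! ### Projections, involutions and slashed bundles -/

variable (X : Mfd.{u})

theorem contMDiff_pi (r : ℕ) : ContMDiff (X.iterT (r + 1)).model (X.iterT r).model ∞ (X.pi r) :=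
  (X.iterT r).contMDiff_proj

theorem contMDiff_piBase (r : ℕ) : ContMDiff (X.iterT r).model X.model ∞ (X.piBase r) := by
  induction r with
  | zero => exact contMDiff_id
  | succ r ih => exact ih.comp (X.contMDiff_pi r)

theorem contMDiff_kappa (r : ℕ) : ContMDiff (X.iterT r).model (X.iterT r).model ∞ (X.kappa r) := by
  match r with
  | 0 => exact contMDiff_id
  | 1 => exact contMDiff_id
  | r + 2 => exact (X.iterT r).contMDiff_flip

theorem isOpen_slashed (r : ℕ) : IsOpen (X.slashed (r + 1)) :=
  isOpen_snd_ne_zero.preimage (contMDiff_D (X.contMDiff_piBase r)).continuous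

theorem D_piBase_succ (r : ℕ) (ξ : X.iterT (r + 2)) :
    D (X := X.iterT (r + 1)) (X.piBase (r + 1)) ξ =
      D (X := X.iterT r) (X.piBase r) (D (X := X.iterT (r + 1)) (Y := X.iterT r) (X.pi r) ξ) :=
  D_comp_apply ((X.contMDiff_pi r).mdifferentiable (by simp) _)
    ((X.contMDiff_piBase r).mdifferentiable (by simp) _)

/-- By functoriality, both elements have the same image in TX. -/
theorem D_pi_mem_slashed_iff (r : ℕ) (ξ : X.iterT (r + 2)) :
    D (X := X.iterT (r + 1)) (Y := X.iterT r) (X.pi r) ξ ∈ X.slashed (r + 1) ↔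
      ξ ∈ X.slashed (r + 2) := by
  have h := X.D_piBase_succ r ξ
  have key : ∀ a b : X.T, a = b → (b.snd ≠ 0 ↔ a.snd ≠ 0) := by
    rintro a b rfl
    rfl
  exact key _ _ h

theorem pi_kappa (r : ℕ) (ξ : X.iterT (r + 2)) :
    X.pi (r + 1) (X.kappa (r + 2) ξ) = D (X := X.iterT (r + 1)) (Y := X.iterT r) (X.pi r) ξ :=
  ((X.iterT r).D_proj_eq_proj_flip ξ).symm

theorem pi_kappa_mem_slashed_iff (r : ℕ) (ξ : X.iterT (r + 2)) :
    X.pi (r + 1) (X.kappa (r + 2) ξ) ∈ X.slashed (r + 1) ↔ ξ ∈ X.slashed (r + 2) := by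
  rw [pi_kappa]
  exact X.D_pi_mem_slashed_iff r ξ

theorem piBase_kappa (r : ℕ) : X.piBase (r + 2) ∘ X.kappa (r + 2) = X.piBase (r + 2) := by
  funext ξ
  have h : ∀ a b : X.iterT (r + 1), a = b → X.piBase (r + 1) a = X.piBase (r + 1) b :=
    fun _ _ h => congrArg _ h
  exact (h _ _ (X.pi_kappa r ξ)).trans rfl

theorem D_kappa_mem_slashed_iff (r : ℕ) (ξ : X.iterT (r + 3)) :
    D (X := X.iterT (r + 2)) (Y := X.iterT (r + 2)) (X.kappa (r + 2)) ξ ∈ X.slashed (r + 3) ↔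
      ξ ∈ X.slashed (r + 3) := by
  have h : D (X := X.iterT (r + 2)) (X.piBase (r + 2)) ξ =
      D (X := X.iterT (r + 2)) (X.piBase (r + 2))
        (D (X := X.iterT (r + 2)) (Y := X.iterT (r + 2)) (X.kappa (r + 2)) ξ) := by
    conv_lhs => rw [← X.piBase_kappa r]
    exact D_comp_apply ((X.contMDiff_kappa (r + 2)).mdifferentiable (by simp) _)
      ((X.contMDiff_piBase (r + 2)).mdifferentiable (by simp) _)
  have key : ∀ a b : X.T, a = b → (b.snd ≠ 0 ↔ a.snd ≠ 0) := by
    rintro a b rfl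
    rfl
  exact key _ _ h

variable {X}

theorem IsGeodesic.comp {r s : ℕ} {S : X.iterT (r + 1) → X.iterT (r + 2)}
    {S' : X.iterT (s + 1) → X.iterT (s + 2)} {I : Set ℝ} (hI : IsOpen I) {γ : ℝ → X.iterT r}
    (hγ : X.IsGeodesic r S I γ) {f : X.iterT r → X.iterT s}
    (hf : ContMDiff (X.iterT r).model (X.iterT s).model ∞ f)
    (hmaps : ∀ ξ ∈ X.slashed (r + 1),
      (D (X := X.iterT r) (Y := X.iterT s) f ξ : X.iterT (s + 1)) ∈ X.slashed (s + 1))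
    (hS : ∀ ξ ∈ X.slashed (r + 1),
      D (X := X.iterT (r + 1)) (Y := X.iterT (s + 1)) (D (X := X.iterT r) (Y := X.iterT s) f) (S ξ) =
        S' (D (X := X.iterT r) (Y := X.iterT s) f ξ)) :
    X.IsGeodesic s S' I (f ∘ γ) := by
  have h1 : ∀ t ∈ I, tangent (f ∘ γ) t = D f (tangent γ t) :=
    fun t ht => tangent_comp hI hγ.smooth hf ht
  refine ⟨hf.comp_contMDiffOn hγ.smooth, fun t ht => ?_, fun t ht => ?_⟩
  · rw [h1 t ht]
    exact hmaps _ (hγ.regular t ht)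
  · rw [h1 t ht, ← hS _ (hγ.regular t ht), ← hγ.eq t ht]
    refine (tangent_congr hI (δ := D f ∘ tangent γ) h1 ht).trans ?_
    exact tangent_comp hI (contMDiffOn_tangent hI hγ.smooth) (contMDiff_D hf) ht

/-! ### One step of the complete lift, and its symmetries -/

variable {X : Mfd.{u}}

/-- The complete lift of a semispray on `Y`, given by its values on `TY`, to a semispray on `TY`. -/
def liftStep (Y : Mfd.{u}) (S : Y.T → Y.T.T) : Y.T.T → Y.T.T.T :=
  D (X := Y.T.T) (Y := Y.T.T) Y.flip ∘ Y.T.flip ∘ D (X := Y.T) (Y := Y.T.T) S ∘ Y.flip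

theorem liftStep_apply (Y : Mfd.{u}) (S : Y.T → Y.T.T) (ξ : Y.T.T) :
    liftStep Y S ξ = D (X := Y.T.T) (Y := Y.T.T) Y.flip
      (Y.T.flip (D (X := Y.T) (Y := Y.T.T) S (Y.flip ξ))) :=
  rfl

theorem contMDiffOn_liftStep {Y : Mfd.{u}} {S : Y.T → Y.T.T} {U : Set Y.T} (hU : IsOpen U)
    (hS : ContMDiffOn Y.T.model Y.T.T.model ∞ S U) :
    ContMDiffOn Y.T.T.model Y.T.T.T.model ∞ (liftStep Y S) ((Y.T.proj ∘ Y.flip) ⁻¹' U) :=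
  (contMDiff_D Y.contMDiff_flip).comp_contMDiffOn <| Y.T.contMDiff_flip.comp_contMDiffOn <|
    (contMDiffOn_D hU hS).comp Y.contMDiff_flip.contMDiffOn fun _ h => h

/-- Cancel from the left: DDπ ∘ Dκ is D of the next projection, that projection's D after κ is a
plain projection, and DS covers S. What remains is S ∘ π ∘ κ = S ∘ Dπ. -/
theorem D_D_proj_liftStep (Y : Mfd.{u}) (S : Y.T → Y.T.T) (ξ : Y.T.T) :
    D (X := Y.T.T) (Y := Y.T) (D (X := Y.T) (Y := Y) Y.proj) (liftStep Y S ξ) =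
      S (D (X := Y.T) (Y := Y) Y.proj ξ) := by
  have h1 : D (X := Y.T) (Y := Y) Y.proj ∘ Y.flip = Y.T.proj := funext Y.D_proj_flip
  have h2 : ∀ ζ : Y.T.T.T, D (X := Y.T.T) (Y := Y.T) (D (X := Y.T) (Y := Y) Y.proj)
      (D (X := Y.T.T) (Y := Y.T.T) Y.flip ζ) = D (X := Y.T.T) (Y := Y.T) Y.T.proj ζ := by
    intro ζ
    rw [← h1]
    exact (D_comp_apply (Y.contMDiff_flip.mdifferentiable (by simp) _)
      ((contMDiff_D Y.contMDiff_proj).mdifferentiable (by simp) _)).symm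
  rw [liftStep_apply, h2]
  refine (Y.T.D_proj_flip _).trans ?_
  exact congrArg S (Y.D_proj_eq_proj_flip ξ).symm

/-- The double lift is the word d' k'' dd d' DDS d k'. A factor dd on the far left is pushed to the
right: naturality and braids turn it into k'' next to DDS, naturality carries k'' across DDS as k',
and a last braid turns k' into d on the far right. -/
theorem D_D_flip_liftStep_liftStep {Y : Mfd.{u}} {S : Y.T → Y.T.T} {U : Set Y.T} (hU : IsOpen U)
    (hS : ContMDiffOn Y.T.model Y.T.T.model ∞ S U) (ξ : Y.T.T.T)
    (hξ : D (X := Y.T) (Y := Y) Y.proj (D (X := Y.T.T) (Y := Y.T) Y.T.proj ξ) ∈ U) :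
    D (X := Y.T.T.T) (Y := Y.T.T.T) (D (X := Y.T.T) (Y := Y.T.T) Y.flip)
        (liftStep Y.T (liftStep Y S) ξ) =
      liftStep Y.T (liftStep Y S) (D (X := Y.T.T) (Y := Y.T.T) Y.flip ξ) := by
  set k := Y.flip with hk
  set k' := Y.T.flip with hk'
  set k'' := Y.T.T.flip with hk''
  set d := D (X := Y.T.T) (Y := Y.T.T) k with hd
  set d' := D (X := Y.T.T.T) (Y := Y.T.T.T) k' with hd'
  set dd := D (X := Y.T.T.T) (Y := Y.T.T.T) d with hdd
  set DS := D (X := Y.T) (Y := Y.T.T) S with hDS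
  set DDS := D (X := Y.T.T) (Y := Y.T.T.T) DS with hDDS
  have hkd : MDifferentiable Y.T.T.model Y.T.T.model k := Y.contMDiff_flip.mdifferentiable (by simp)
  have hk'd : MDifferentiable Y.T.T.T.model Y.T.T.T.model k' :=
    Y.T.contMDiff_flip.mdifferentiable (by simp)
  have hds : ContMDiff Y.T.T.T.model Y.T.T.T.model ∞ d := contMDiff_D Y.contMDiff_flip
  have hdd' : MDifferentiable Y.T.T.T.model Y.T.T.T.model d := hds.mdifferentiable (by simp)
  -- naturality of the involution with respect to itself
  have n1 : ∀ ζ, k'' (dd ζ) = dd (k'' ζ) := fun ζ =>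
    (D_D_flip isOpen_univ Y.contMDiff_flip.contMDiffOn ζ (mem_univ _)).symm
  have n2 : ∀ ζ : Y.T.T.T, ζ.proj.proj ∈ U → k'' (DDS ζ) = DDS (k' ζ) := fun ζ hζ =>
    (D_D_flip hU hS ζ hζ).symm
  -- braid relations
  have b1 : ∀ ζ, d (k' (d ζ)) = k' (d (k' ζ)) := Y.flip_braid
  have b2 : ∀ ζ, d' (k'' (d' ζ)) = k'' (d' (k'' ζ)) := Y.T.flip_braid
  -- This is D applied to the relation `b1`.
  have b3 : ∀ ζ, dd (d' (dd ζ)) = d' (dd (d' ζ)) := by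
    intro ζ
    have hb : d ∘ k' ∘ d = k' ∘ d ∘ k' := funext b1
    have e1 : D (X := Y.T.T.T) (Y := Y.T.T.T) (d ∘ k' ∘ d) ζ = dd (d' (dd ζ)) :=
      (D_comp_apply ((hk'd.comp hdd') _) (hdd' _)).trans
        (congrArg dd (D_comp_apply (hdd' _) (hk'd _)))
    have e2 : D (X := Y.T.T.T) (Y := Y.T.T.T) (k' ∘ d ∘ k') ζ = d' (dd (d' ζ)) :=
      (D_comp_apply ((hdd'.comp hk'd) _) (hk'd _)).trans
        (congrArg d' (D_comp_apply (hk'd _) (hdd' _)))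
    rw [← e1, ← e2, hb]
  -- the derivative of the first lift
  have hDSd : ∀ ζ : Y.T.T, ζ.proj ∈ U → MDifferentiableAt Y.T.T.model Y.T.T.T.model DS ζ :=
    fun ζ hζ => ((contMDiffOn_D hU hS).contMDiffAt
      ((hU.preimage Y.T.contMDiff_proj.continuous).mem_nhds hζ)).mdifferentiableAt (by simp)
  have hL : ∀ ζ : Y.T.T.T, (k ζ.proj).proj ∈ U →
      D (X := Y.T.T) (Y := Y.T.T.T) (liftStep Y S) ζ = dd (d' (DDS (d ζ))) := by
    intro ζ hζ
    have m1 : MDifferentiableAt Y.T.T.model Y.T.T.T.model (DS ∘ k) ζ.proj :=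
      (hDSd _ hζ).comp _ (hkd _)
    have m2 : MDifferentiableAt Y.T.T.model Y.T.T.T.model (k' ∘ DS ∘ k) ζ.proj :=
      (hk'd _).comp _ m1
    exact (D_comp_apply m2 (hdd' _)).trans (congrArg dd ((D_comp_apply m1 (hk'd _)).trans
      (congrArg d' (D_comp_apply (hkd _) (hDSd _ hζ)))))
  have hξ1 : (k (k' ξ).proj).proj ∈ U := by
    have e1 : D (X := Y.T.T) (Y := Y.T) Y.T.proj ξ = (k' ξ).proj := Y.T.D_proj_eq_proj_flip ξ
    have e2 : D (X := Y.T) (Y := Y) Y.proj (k' ξ).proj = (k (k' ξ).proj).proj :=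
      Y.D_proj_eq_proj_flip _
    rwa [e1, e2] at hξ
  -- After the braid the outermost map is k', which preserves the base point.
  have hξ2 : (d (k' (d ξ))).proj.proj ∈ U := by
    rw [b1]
    exact hξ1
  calc dd (d' (k'' (D (X := Y.T.T) (Y := Y.T.T.T) (liftStep Y S) (k' ξ))))
      = dd (d' (k'' (dd (d' (DDS (d (k' ξ))))))) := by rw [hL _ hξ1]
    _ = dd (d' (dd (k'' (d' (DDS (d (k' ξ))))))) := by rw [n1]
    _ = d' (dd (d' (k'' (d' (DDS (d (k' ξ))))))) := by rw [b3]
    _ = d' (dd (k'' (d' (k'' (DDS (d (k' ξ))))))) := by rw [b2]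
    _ = d' (dd (k'' (d' (DDS (k' (d (k' ξ))))))) := by rw [n2 _ hξ1]
    _ = d' (k'' (dd (d' (DDS (d (k' (d ξ))))))) := by rw [n1, b1]
    _ = d' (k'' (D (X := Y.T.T) (Y := Y.T.T.T) (liftStep Y S) (k' (d ξ)))) := by rw [hL _ hξ2]

/-! ### The three statements for iterated lifts -/

theorem contMDiffOn_completeLift {S : X.iterT 1 → X.iterT 2}
    (hS : ContMDiffOn (X.iterT 1).model (X.iterT 2).model ∞ S (X.slashed 1)) (r : ℕ) :
    ContMDiffOn (X.iterT (r + 1)).model (X.iterT (r + 2)).model ∞ (X.completeLift S r)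
      (X.slashed (r + 1)) := by
  induction r with
  | zero => exact hS
  | succ r ih =>
    -- The lift is smooth over the preimage of the slashed bundle under π ∘ κ = Dπ, which is the
    -- next slashed bundle.
    exact (contMDiffOn_liftStep (Y := X.iterT r) (X.isOpen_slashed r) ih).mono
      fun ξ hξ => (X.pi_kappa_mem_slashed_iff r ξ).2 hξ

theorem IsGeodesic.pi_comp {S : X.iterT 1 → X.iterT 2} {I : Set ℝ} (hI : IsOpen I) {r : ℕ}
    {j : ℝ → X.iterT (r + 1)} (hj : X.IsGeodesic (r + 1) (X.completeLift S (r + 1)) I j) :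
    X.IsGeodesic r (X.completeLift S r) I (X.pi r ∘ j) :=
  hj.comp hI (X.contMDiff_pi r) (fun ξ hξ => (X.D_pi_mem_slashed_iff r ξ).2 hξ)
    fun ξ _ => D_D_proj_liftStep (X.iterT r) (X.completeLift S r) ξ

theorem IsGeodesic.kappa_comp {S : X.iterT 1 → X.iterT 2}
    (hS : ContMDiffOn (X.iterT 1).model (X.iterT 2).model ∞ S (X.slashed 1))
    {I : Set ℝ} (hI : IsOpen I) {r : ℕ}
    {j : ℝ → X.iterT (r + 2)} (hj : X.IsGeodesic (r + 2) (X.completeLift S (r + 2)) I j) :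
    X.IsGeodesic (r + 2) (X.completeLift S (r + 2)) I (X.kappa (r + 2) ∘ j) :=
  hj.comp hI (X.contMDiff_kappa (r + 2)) (fun ξ hξ => (X.D_kappa_mem_slashed_iff r ξ).2 hξ)
    fun ξ hξ => D_D_flip_liftStep_liftStep (Y := X.iterT r) (X.isOpen_slashed r)
      (contMDiffOn_completeLift hS r) ξ ((X.D_pi_mem_slashed_iff r _).2
        ((X.D_pi_mem_slashed_iff (r + 1) ξ).2 hξ))

theorem IsGeodesic.D_pi_comp {S : X.iterT 1 → X.iterT 2}
    (hS : ContMDiffOn (X.iterT 1).model (X.iterT 2).model ∞ S (X.slashed 1))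
    {I : Set ℝ} (hI : IsOpen I) {r : ℕ}
    {j : ℝ → X.iterT (r + 2)} (hj : X.IsGeodesic (r + 2) (X.completeLift S (r + 2)) I j) :
    X.IsGeodesic (r + 1) (X.completeLift S (r + 1)) I
      (D (X := X.iterT (r + 1)) (Y := X.iterT r) (X.pi r) ∘ j) := by
  have h : X.pi (r + 1) ∘ X.kappa (r + 2) ∘ j =
      D (X := X.iterT (r + 1)) (Y := X.iterT r) (X.pi r) ∘ j :=
    funext fun t => X.pi_kappa r (j t)
  exact Eq.subst (motive := X.IsGeodesic (r + 1) (X.completeLift S (r + 1)) I) h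
    ((hj.kappa_comp hS hI).pi_comp hI)

end IteratedLift.Mfd

end

theorem mainTheorem7 {n : ℕ} (hn : 1 ≤ n) {M : Type*} [TopologicalSpace M] [T2Space M]
    [SecondCountableTopology M] [ChartedSpace (EuclideanSpace ℝ (Fin n)) M]
    [IsManifold (𝓡 n) ∞ M]
    (S : (IteratedLift.Mfd.of n M).iterT 1 → (IteratedLift.Mfd.of n M).iterT 2)
    (hS : (IteratedLift.Mfd.of n M).IsSemispray 0 S)
    (I : Set ℝ) (hI : IsOpen I) (hI' : I.OrdConnected) (hI0 : (0 : ℝ) ∈ I) :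
    let X := IteratedLift.Mfd.of n M
    (∀ (r : ℕ) (j : ℝ → X.iterT (r + 1)),
      X.IsGeodesic (r + 1) (X.completeLift S (r + 1)) I j →
        X.IsGeodesic r (X.completeLift S r) I (X.pi r ∘ j)) ∧
    (∀ (r : ℕ) (j : ℝ → X.iterT (r + 2)),
      X.IsGeodesic (r + 2) (X.completeLift S (r + 2)) I j →
        X.IsGeodesic (r + 2) (X.completeLift S (r + 2)) I (X.kappa (r + 2) ∘ j)) ∧
    (∀ (r : ℕ) (j : ℝ → X.iterT (r + 2)),
      X.IsGeodesic (r + 2) (X.completeLift S (r + 2)) I j →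
        X.IsGeodesic (r + 1) (X.completeLift S (r + 1)) I
          (IteratedLift.Mfd.D (X := X.iterT (r + 1)) (Y := X.iterT r) (X.pi r) ∘ j)) := by
  intro X
  have hS0 : ContMDiffOn (X.iterT 1).model (X.iterT 2).model ∞ S (X.slashed 1) := hS.smooth
  exact ⟨fun r j hj => hj.pi_comp hI, fun r j hj => hj.kappa_comp hS0 hI,
    fun r j hj => hj.D_pi_comp hS0 hI⟩
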